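/- There are a constant $\kappa>0$ and, for every integer $n\ge 1$, two nonempty families $\mathcal S_0=\mathcal S_0(n)$ and $\mathcal S_1=\mathcal S_1(n)$ of triples of nonempty subsets of $\{0,1\}^n$ such that $$|A\cap B\cap C|/2^n\ge \tfrac1{16}\ \text{ for all }(A,B,C)\in\mathcal S_0,\qquad |A\cap B\cap C|/2^n=0\ \text{ for all }(A,B,C)\in\mathcal S_1,$$ and yet any quantum algorithm distinguishing the two families from copies of their subset states requires $\Omega(2^{n/2})$ copies of $|A\rangle$, $|B\rangle$ or $|C\rangle$. Here the subset state of a nonempty $S\subseteq\{0,1\}^n$ is $|S\rangle=|S|^{-1/2}\sum_{x\in S}|x\rangle$, and the lower bound means the following: let $a,b,c\ge 0$ be integers and suppose that there is a two-outcome quantum measurement $\{E,I-E\}$ ($0\le E\le I$) on $|A\rangle^{\otimes a}\otimes|B\rangle^{\otimes b}\otimes|C\rangle^{\otimes c}$ that has outcome $E$ with probability at least $2/3$ for every $(A,B,C)\in\mathcal S_0$ and outcome $I-E$ with probability at least $2/3$ for every $(A,B,C)\in\mathcal S_1$; then $\max(a,b,c)\ge\kappa\,2^{n/2}$. -/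

import Mathlib

open scoped ComplexOrder

/-- The Boolean hypercube `{0,1}^n`. -/
abbrev BitString (n : ℕ) : Type := Fin n → Bool

/-- Ordered triples `(A, B, C)` of subsets of `{0,1}^n`. -/
abbrev SetTriple (n : ℕ) : Type :=
  Finset (BitString n) × Finset (BitString n) × Finset (BitString n)

/-- The fractional size `|A ∩ B ∩ C| / 2^n` of the triple intersection. -/
noncomputable def tripleIntersectionDensity {n : ℕ} (T : SetTriple n) : ℝ :=
  ((T.1 ∩ T.2.1 ∩ T.2.2).card : ℝ) / 2 ^ n

/-- The subset state `|S⟩ = |S|^{-1/2} ∑_{x ∈ S} |x⟩`, as the vector of its amplitudes in the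
computational basis. It is a unit vector when `S` is nonempty. -/
noncomputable def subsetState {n : ℕ} (S : Finset (BitString n)) : BitString n → ℂ :=
  fun x => if x ∈ S then ((1 / Real.sqrt (S.card : ℝ) : ℝ) : ℂ) else 0

/-- The `t`-fold tensor power `|ψ⟩^{⊗t}`, in the product basis. -/
def tensorPow {ι : Type*} (ψ : ι → ℂ) (t : ℕ) : (Fin t → ι) → ℂ :=
  fun x => ∏ i, ψ (x i)

/-- The tensor product `|φ⟩ ⊗ |ψ⟩`, in the product basis. -/
def tensorProd {ι κ : Type*} (φ : ι → ℂ) (ψ : κ → ℂ) : ι × κ → ℂ :=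
  fun p => φ p.1 * ψ p.2

/-- Index set of the computational basis of `a + b + c` registers of `n` qubits each. -/
abbrev CopyBasis (n a b c : ℕ) : Type :=
  (Fin a → BitString n) × (Fin b → BitString n) × (Fin c → BitString n)

/-- The joint state `|A⟩^{⊗a} ⊗ |B⟩^{⊗b} ⊗ |C⟩^{⊗c}` for `T = (A, B, C)`. -/
noncomputable def copiesState {n : ℕ} (T : SetTriple n) (a b c : ℕ) : CopyBasis n a b c → ℂ :=
  tensorProd (tensorPow (subsetState T.1) a)
    (tensorProd (tensorPow (subsetState T.2.1) b) (tensorPow (subsetState T.2.2) c))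

/-- `E` is the "accept" element of a two-outcome quantum measurement `{E, 1 - E}` (a POVM).
Every quantum algorithm with a one-bit output acting on the registers indexed by `ι`, with
arbitrary ancillas, entangling operations and intermediate measurements, induces one. -/
structure IsEffect {ι : Type*} [Fintype ι] [DecidableEq ι] (E : Matrix ι ι ℂ) : Prop where
  posSemidef : E.PosSemidef
  compl_posSemidef : (1 - E).PosSemidef

/-- The acceptance probability `⟨ψ| E |ψ⟩` of the measurement `{E, 1 - E}` on the state `|ψ⟩`. -/
noncomputable def acceptProb {ι : Type*} [Fintype ι] (E : Matrix ι ι ℂ) (ψ : ι → ℂ) : ℝ :=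
  (star ψ ⬝ᵥ Matrix.mulVec E ψ).re

/-- The families `S₀` and `S₁` can be distinguished, with success probability at least `2/3` on
every member of either family, by a quantum algorithm that is given `a` copies of `|A⟩`,
`b` copies of `|B⟩` and `c` copies of `|C⟩` (accepting means answering `S₀`). -/
def DistinguishableFromCopies {n : ℕ} (S₀ S₁ : Set (SetTriple n)) (a b c : ℕ) : Prop :=
  ∃ E : Matrix (CopyBasis n a b c) (CopyBasis n a b c) ℂ, IsEffect E ∧
    (∀ T ∈ S₀, 2 / 3 ≤ acceptProb E (copiesState T a b c)) ∧
    (∀ T ∈ S₁, 2 / 3 ≤ 1 - acceptProb E (copiesState T a b c))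

/-!
Cut the cube into blocks of four points and translate every block by an independent uniform mask.
Inside a block, place either three two-point sets with a common point or three two-point sets with
empty intersection, chosen so that any *two* of the three look the same in both cases up to
translation.

Average the density matrix of the copies over the masks. If two basis vectors each have their
registers in pairwise distinct blocks, then a block contains at most one register of either vector,
so the entry they index involves at most two of the three sets there and is the same in both cases.
By the birthday bound the remaining basis vectors carry a mass of at most `(a + b + c)² / 2 ^ m`,
where `2 ^ m` is the number of blocks. A measurement that separates the two cases must detect this
mass, so the total number of copies is at least of order `2 ^ (n / 2)`.
-/

section Effects

variable {ι : Type*} [Fintype ι] {E : Matrix ι ι ℂ}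

theorem acceptProb_eq_re_sum (E : Matrix ι ι ℂ) (ψ : ι → ℂ) :
    acceptProb E ψ = (∑ i, ∑ j, E i j * (star (ψ i) * ψ j)).re := by
  simp only [acceptProb, dotProduct, Matrix.mulVec, Finset.mul_sum, Pi.star_apply,
    mul_left_comm]

theorem sum_acceptProb_congr {R : Type*} [Fintype R] {φ ψ : R → ι → ℂ}
    (h : ∀ i j, ∑ r, star (φ r i) * φ r j = ∑ r, star (ψ r i) * ψ r j) :
    ∑ r, acceptProb E (φ r) = ∑ r, acceptProb E (ψ r) := by
  have sum_eq (χ : R → ι → ℂ) :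
      ∑ r, acceptProb E (χ r) = (∑ i, ∑ j, E i j * ∑ r, star (χ r i) * χ r j).re := by
    simp_rw [acceptProb_eq_re_sum, ← Complex.re_sum, Finset.mul_sum]
    rw [Finset.sum_comm]
    simp_rw [Finset.sum_comm (s := (Finset.univ : Finset R))]
  simp only [sum_eq, h]

theorem acceptProb_nonneg (hE : E.PosSemidef) (ψ : ι → ℂ) : 0 ≤ acceptProb E ψ :=
  (Complex.le_def.1 (hE.dotProduct_mulVec_nonneg ψ)).1

theorem acceptProb_add_le_of_posSemidef (hE : E.PosSemidef) {t : ℝ} (ht : 0 < t)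
    (φ χ : ι → ℂ) :
    acceptProb E (φ + χ) ≤ (1 + t) * acceptProb E φ + (1 + t⁻¹) * acceptProb E χ := by
  have expand : acceptProb E (t • φ - χ) =
      (t ^ 2 + t) * acceptProb E φ + (1 + t) * acceptProb E χ - t * acceptProb E (φ + χ) := by
    simp only [acceptProb_eq_re_sum, ← Complex.re_ofReal_mul, ← Complex.add_re, ← Complex.sub_re,
      Finset.mul_sum, ← Finset.sum_add_distrib, ← Finset.sum_sub_distrib]
    refine congrArg Complex.re <| Finset.sum_congr rfl fun i _ => Finset.sum_congr rfl fun j _ => ?_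
    simp only [Pi.sub_apply, Pi.add_apply, Pi.smul_apply, Complex.real_smul, star_sub, star_add,
      star_mul', RCLike.star_def, Complex.conj_ofReal]
    push_cast
    ring
  have nonneg := acceptProb_nonneg hE (t • φ - χ)
  refine le_of_mul_le_mul_left ?_ ht
  calc t * acceptProb E (φ + χ)
      ≤ (t ^ 2 + t) * acceptProb E φ + (1 + t) * acceptProb E χ := by linarith
    _ = t * ((1 + t) * acceptProb E φ + (1 + t⁻¹) * acceptProb E χ) := by
      field_simp
      ring

variable [DecidableEq ι]

theorem IsEffect.acceptProb_le_sum_normSq (hE : IsEffect E) (ψ : ι → ℂ) :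
    acceptProb E ψ ≤ ∑ i, Complex.normSq (ψ i) := by
  have compl : acceptProb (1 - E) ψ = ∑ i, Complex.normSq (ψ i) - acceptProb E ψ := by
    simp [acceptProb, Matrix.sub_mulVec, dotProduct, mul_sub, Complex.normSq_apply]
  linarith [acceptProb_nonneg hE.compl_posSemidef ψ]

theorem IsEffect.acceptProb_add_le (hE : IsEffect E) {t : ℝ} (ht : 0 < t) (φ χ : ι → ℂ) :
    acceptProb E (φ + χ) ≤
      (1 + t) * acceptProb E φ + (1 + t⁻¹) * ∑ i, Complex.normSq (χ i) :=
  (acceptProb_add_le_of_posSemidef hE.posSemidef ht φ χ).trans <| by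
    gcongr
    exact hE.acceptProb_le_sum_normSq χ

theorem IsEffect.one_div_ninety_le_of_gram_eq {R : Type*} [Fintype R] [Nonempty R]
    (hE : IsEffect E) {φ ψ : R → ι → ℂ} {G : Set ι} {ε : ℝ}
    (gram_eq : ∀ i ∈ G, ∀ j ∈ G, ∑ r, star (φ r i) * φ r j = ∑ r, star (ψ r i) * ψ r j)
    (hφ : ∀ r, ∑ i, Complex.normSq (Gᶜ.indicator (φ r) i) ≤ ε)
    (hψ : ∀ r, ∑ i, Complex.normSq (Gᶜ.indicator (ψ r) i) ≤ ε)
    (accept : ∀ r, 2 / 3 ≤ acceptProb E (φ r)) (reject : ∀ r, 2 / 3 ≤ 1 - acceptProb E (ψ r)) :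
    1 / 90 ≤ ε := by
  have sum_eq : ∑ r, acceptProb E (G.indicator (φ r)) = ∑ r, acceptProb E (G.indicator (ψ r)) := by
    refine sum_acceptProb_congr fun i j => ?_
    by_cases hi : i ∈ G
    · by_cases hj : j ∈ G
      · simpa only [Set.indicator_of_mem hi, Set.indicator_of_mem hj] using gram_eq i hi j hj
      · simp [hj]
    · simp [hi]
  have lower (r : R) : 8 / 15 - 4 * ε ≤ acceptProb E (G.indicator (φ r)) := by
    have h := hE.acceptProb_add_le (t := 1 / 4) (by norm_num) (G.indicator (φ r))
      (Gᶜ.indicator (φ r))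
    rw [Set.indicator_self_add_compl] at h
    linarith [accept r, hφ r]
  have upper (r : R) : acceptProb E (G.indicator (ψ r)) ≤ 5 / 12 + 5 * ε := by
    have h := hE.acceptProb_add_le (t := 1 / 4) (by norm_num) (ψ r) (-Gᶜ.indicator (ψ r))
    rw [← sub_eq_add_neg, sub_eq_of_eq_add (Set.indicator_self_add_compl G (ψ r)).symm] at h
    simp only [Pi.neg_apply, Complex.normSq_neg] at h
    linarith [reject r, hψ r]
  have averaged : 8 / 15 - 4 * ε ≤ 5 / 12 + 5 * ε := by
    obtain ⟨r, -, hr⟩ := Finset.exists_le_of_sum_le Finset.univ_nonempty sum_eq.le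
    exact (lower r).trans (hr.trans (upper r))
  linarith

end Effects

section Collisions

variable {P X W : Type*} [Fintype P] [DecidableEq P] [Fintype X]

theorem sum_prod_filter_mem_and_mem [DecidableEq X] {R : Type*} [CommSemiring R] {μ : P → X → R}
    (hμ : ∀ i, ∑ x, μ i x = 1) {p q : P} (hpq : p ≠ q) (S T : Finset X) :
    ∑ k : P → X with k p ∈ S ∧ k q ∈ T, ∏ i, μ i (k i) =
      (∑ x ∈ S, μ p x) * ∑ x ∈ T, μ q x := by
  let U : P → Finset X := Function.update (Function.update (fun _ => Finset.univ) p S) q T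
  have hUp : U p = S := by simp [U, hpq]
  have hUq : U q = T := by simp [U]
  have hU (i : P) (hi : i ≠ p ∧ i ≠ q) : U i = Finset.univ := by simp [U, hi.1, hi.2]
  have filter_eq : ({k | k p ∈ S ∧ k q ∈ T} : Finset (P → X)) = Fintype.piFinset U := by
    ext k
    simp only [Finset.mem_filter_univ, Fintype.mem_piFinset]
    refine ⟨fun hk i => ?_, fun hk => ⟨hUp ▸ hk p, hUq ▸ hk q⟩⟩
    grind
  rw [filter_eq, ← Finset.prod_univ_sum, Fintype.prod_eq_mul p q hpq fun i hi => by
    rw [hU i hi, hμ], hUp, hUq]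

variable [DecidableEq W] {g : X → W} {μ : P → X → ℝ} {δ : ℝ}

theorem sum_prod_filter_apply_eq_apply_le (hμ₀ : ∀ i x, 0 ≤ μ i x)
    (hμ : ∀ i, ∑ x, μ i x = 1) (hδ : ∀ i w, ∑ x with g x = w, μ i x ≤ δ) {p q : P}
    (hpq : p ≠ q) :
    ∑ k : P → X with g (k p) = g (k q), ∏ i, μ i (k i) ≤ δ := by
  classical
  calc ∑ k : P → X with g (k p) = g (k q), ∏ i, μ i (k i)
      = ∑ w ∈ Finset.univ.image g, ∑ k : P → X with k p ∈ ({x | g x = w} : Finset X) ∧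
          k q ∈ ({x | g x = w} : Finset X), ∏ i, μ i (k i) := by
        rw [← Finset.sum_fiberwise_of_maps_to fun (k : P → X) _ =>
          Finset.mem_image_of_mem g (Finset.mem_univ (k q))]
        refine Finset.sum_congr rfl fun w _ => Finset.sum_congr ?_ fun _ _ => rfl
        grind
    _ = ∑ w ∈ Finset.univ.image g, (∑ x with g x = w, μ p x) * ∑ x with g x = w, μ q x :=
        Finset.sum_congr rfl fun w _ => sum_prod_filter_mem_and_mem hμ hpq _ _
    _ ≤ ∑ w ∈ Finset.univ.image g, δ * ∑ x with g x = w, μ q x := by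
        gcongr with w
        · exact Finset.sum_nonneg fun x _ => hμ₀ q x
        · exact hδ p w
    _ = δ := by rw [← Finset.mul_sum, Finset.sum_fiberwise_of_maps_to fun x _ =>
          Finset.mem_image_of_mem g (Finset.mem_univ x), hμ, mul_one]

theorem sum_prod_filter_not_injective_le (hμ₀ : ∀ i x, 0 ≤ μ i x)
    (hμ : ∀ i, ∑ x, μ i x = 1) (hδ₀ : 0 ≤ δ) (hδ : ∀ i w, ∑ x with g x = w, μ i x ≤ δ)
    [DecidablePred fun k : P → X => Function.Injective (g ∘ k)] :
    ∑ k : P → X with ¬ Function.Injective (g ∘ k), ∏ i, μ i (k i) ≤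
      (Fintype.card P : ℝ) ^ 2 * δ := by
  have weight_nonneg (k : P → X) : 0 ≤ ∏ i, μ i (k i) := Finset.prod_nonneg fun i _ => hμ₀ i _
  have exists_collision (k : P → X) (hk : ¬ Function.Injective (g ∘ k)) :
      ∃ pq ∈ Finset.univ.offDiag, g (k pq.1) = g (k pq.2) := by
    obtain ⟨p, q, hg, hpq⟩ := Function.not_injective_iff.1 hk
    exact ⟨(p, q), by simpa using hpq, hg⟩
  calc ∑ k : P → X with ¬ Function.Injective (g ∘ k), ∏ i, μ i (k i)
      ≤ ∑ k : P → X, ∑ pq ∈ Finset.univ.offDiag,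
          if g (k pq.1) = g (k pq.2) then ∏ i, μ i (k i) else 0 := by
        rw [Finset.sum_filter]
        gcongr with k
        have terms_nonneg : ∀ pq ∈ (Finset.univ : Finset P).offDiag,
            0 ≤ if g (k pq.1) = g (k pq.2) then ∏ i, μ i (k i) else 0 := fun _ _ =>
          ite_nonneg (weight_nonneg k) le_rfl
        split_ifs with hk
        · exact Finset.sum_nonneg terms_nonneg
        · obtain ⟨pq, hmem, hpq⟩ := exists_collision k hk
          exact (if_pos hpq).ge.trans (Finset.single_le_sum terms_nonneg hmem)
    _ = ∑ pq ∈ (Finset.univ : Finset P).offDiag,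
          ∑ k : P → X with g (k pq.1) = g (k pq.2), ∏ i, μ i (k i) := by
        rw [Finset.sum_comm]
        simp only [Finset.sum_filter]
    _ ≤ ∑ _pq ∈ (Finset.univ : Finset P).offDiag, δ := by
        gcongr with pq hpq
        exact sum_prod_filter_apply_eq_apply_le hμ₀ hμ hδ (Finset.mem_offDiag.1 hpq).2.2
    _ ≤ (Fintype.card P : ℝ) ^ 2 * δ := by
        rw [Finset.sum_const, nsmul_eq_mul]
        gcongr
        rw [Finset.offDiag_card, Finset.card_univ, sq]
        exact_mod_cast Nat.sub_le _ _

end Collisions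

section SubsetStates

variable {n : ℕ}

theorem normSq_subsetState (S : Finset (BitString n)) (x : BitString n) :
    Complex.normSq (subsetState S x) = if x ∈ S then (S.card : ℝ)⁻¹ else 0 := by
  unfold subsetState
  split_ifs <;> simp

theorem sum_normSq_subsetState {S : Finset (BitString n)} (hS : S.Nonempty) :
    ∑ x, Complex.normSq (subsetState S x) = 1 := by
  simp [normSq_subsetState, hS.card_ne_zero]

theorem subsetState_congr {S T : Finset (BitString n)} {x y : BitString n}
    (hcard : S.card = T.card) (hmem : x ∈ S ↔ y ∈ T) : subsetState S x = subsetState T y := by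
  simp only [subsetState, hcard, hmem]

end SubsetStates

section MaskedSets

variable {m q : ℕ}

/-- The cube `{0,1}^(m + q)` cut into `2 ^ m` blocks of `2 ^ q` points: the first `m` bits of a
point say in which block it lies, the last `q` bits where in that block. -/
def blockEquiv : BitString (m + q) ≃ BitString m × BitString q := (Fin.appendEquiv m q).symm

/-- The block in which a point lies. -/
def blockIndex (x : BitString (m + q)) : BitString m := (blockEquiv x).1

/-- The subset of the cube that meets the block `w` in the copy of `Q` translated by the mask
`r w`; addition of bit strings is bitwise exclusive or. -/
def maskedSet (r : BitString m → BitString q) (Q : Finset (BitString q)) :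
    Finset (BitString (m + q)) :=
  {x | (blockEquiv x).2 + r (blockIndex x) ∈ Q}

variable (r : BitString m → BitString q) (Q Q' : Finset (BitString q))

theorem mem_maskedSet {x : BitString (m + q)} :
    x ∈ maskedSet r Q ↔ (blockEquiv x).2 + r (blockIndex x) ∈ Q := by
  simp [maskedSet]

theorem maskedSet_inter : maskedSet r Q ∩ maskedSet r Q' = maskedSet r (Q ∩ Q') := by
  ext x
  simp [mem_maskedSet]

theorem card_filter_maskedSet_blockIndex (w : BitString m) :
    {x ∈ maskedSet r Q | blockIndex x = w}.card = Q.card := by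
  refine Finset.card_bij' (fun x _ => (blockEquiv x).2 + r w)
    (fun v _ => blockEquiv.symm (w, v - r w)) ?_ ?_ ?_ ?_
  · intro x hx
    obtain ⟨hmem, hblock⟩ := Finset.mem_filter.1 hx
    exact hblock ▸ (mem_maskedSet r Q).1 hmem
  · intro v hv
    exact Finset.mem_filter.2 ⟨by simp [mem_maskedSet, blockIndex, hv], by simp [blockIndex]⟩
  · intro x hx
    obtain ⟨-, rfl⟩ := Finset.mem_filter.1 hx
    simp [blockIndex]
  · simp

theorem card_maskedSet : (maskedSet r Q).card = 2 ^ m * Q.card := by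
  rw [Finset.card_eq_sum_card_fiberwise (f := blockIndex) (t := Finset.univ) (by simp)]
  simp [card_filter_maskedSet_blockIndex]

variable {Q}

theorem maskedSet_nonempty (hQ : Q.Nonempty) : (maskedSet r Q).Nonempty := by
  rw [← Finset.card_pos, card_maskedSet]
  have := hQ.card_pos
  positivity

theorem sum_normSq_subsetState_maskedSet_block (hQ : Q.Nonempty) (w : BitString m) :
    ∑ x with blockIndex x = w, Complex.normSq (subsetState (maskedSet r Q) x) =
      1 / 2 ^ m := by
  have hcard : (Q.card : ℝ) ≠ 0 := by exact_mod_cast hQ.card_ne_zero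
  have filter_eq : ({x | blockIndex x = w ∧ x ∈ maskedSet r Q} : Finset _) =
      {x ∈ maskedSet r Q | blockIndex x = w} := by
    grind
  simp only [normSq_subsetState, ← Finset.sum_filter, Finset.filter_filter, filter_eq,
    Finset.sum_const, card_filter_maskedSet_blockIndex, card_maskedSet, nsmul_eq_mul,
    Nat.cast_mul, Nat.cast_pow, Nat.cast_ofNat]
  field_simp

end MaskedSets

/-- With `D l v` saying that the translation `v` is right for the label `l`: each `w` is hit at
most once by `g` and at most once by `g'`, so one translation serves both labels found at `w`. -/
theorem exists_common_choice {P W L V : Type*} [Nonempty L] {D : L → V → Prop}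
    (hD : ∀ l l', ∃ v, D l v ∧ D l' v) (lab : P → L) {g g' : P → W}
    (hg : Function.Injective g) (hg' : Function.Injective g') :
    ∃ d : W → V, ∀ p, D (lab p) (d (g p)) ∧ D (lab p) (d (g' p)) := by
  choose common hleft hright using hD
  let l₀ : L := Classical.arbitrary L
  refine ⟨fun w => common (Function.extend g lab (fun _ => l₀) w)
    (Function.extend g' lab (fun _ => l₀) w), fun p => ⟨?_, ?_⟩⟩
  · simpa only [hg.extend_apply] using hleft (lab p) _
  · simpa only [hg'.extend_apply] using hright _ (lab p)

section HardTriples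

variable {m : ℕ}

/-- Three two-element subsets of the four-point block. Any two of them have the same joint
position up to translation for both values of `s`, but only for `s = false` do all three meet. -/
def blockSet (s : Bool) : Fin 3 → Finset (BitString 2)
  | 0 => {v | v 0 = true}
  | 1 => {v | v 1 = true}
  | 2 => {v | v 0 + v 1 = s}

theorem blockSet_nonempty (s : Bool) (l : Fin 3) : (blockSet s l).Nonempty := by
  revert s l
  decide

theorem card_blockSet_true_eq (l : Fin 3) : (blockSet true l).card = (blockSet false l).card := by
  revert l
  decide

theorem exists_common_blockSet_translation (l l' : Fin 3) :
    ∃ d, (∀ v, v + d ∈ blockSet true l ↔ v ∈ blockSet false l) ∧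
      ∀ v, v + d ∈ blockSet true l' ↔ v ∈ blockSet false l' := by
  revert l l'
  decide

/-- The triple of masked sets with blocks `blockSet s`. -/
def maskedTriple (s : Bool) (r : BitString m → BitString 2) : SetTriple (m + 2) :=
  (maskedSet r (blockSet s 0), maskedSet r (blockSet s 1), maskedSet r (blockSet s 2))

theorem tripleIntersectionDensity_maskedTriple (s : Bool) (r : BitString m → BitString 2) :
    tripleIntersectionDensity (maskedTriple s r) =
      ((blockSet s 0 ∩ blockSet s 1 ∩ blockSet s 2).card : ℝ) / 4 := by
  simp only [tripleIntersectionDensity, maskedTriple, maskedSet_inter, card_maskedSet, pow_add,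
    Nat.cast_mul, Nat.cast_pow, Nat.cast_ofNat]
  field_simp
  norm_num

/-- The basis labels of all `a + b + c` registers, as one function on the registers. -/
def registers (n a b c : ℕ) : CopyBasis n a b c ≃ (Fin a ⊕ Fin b ⊕ Fin c → BitString n) :=
  ((Equiv.refl _).prodCongr (Equiv.sumArrowEquivProdArrow _ _ _).symm).trans
    (Equiv.sumArrowEquivProdArrow _ _ _).symm

/-- Which of the sets `A`, `B`, `C` the state of a register is built from. -/
def registerLabel {a b c : ℕ} : Fin a ⊕ Fin b ⊕ Fin c → Fin 3 :=
  Sum.elim (fun _ => 0) (Sum.elim (fun _ => 1) fun _ => 2)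

variable {a b c : ℕ}

theorem copiesState_maskedTriple (s : Bool) (r : BitString m → BitString 2)
    (k : CopyBasis (m + 2) a b c) :
    copiesState (maskedTriple s r) a b c k =
      ∏ p, subsetState (maskedSet r (blockSet s (registerLabel p))) (registers _ a b c k p) := by
  simp only [Fintype.prod_sum_type, copiesState, tensorProd, tensorPow, maskedTriple]
  rfl

variable (m a b c) in
/-- The basis vectors whose registers lie in pairwise distinct blocks. -/
def collisionFree : Set (CopyBasis (m + 2) a b c) :=
  {k | Function.Injective (blockIndex ∘ registers _ a b c k)}

theorem gram_copiesState_maskedTriple_eq {k k' : CopyBasis (m + 2) a b c}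
    (hk : k ∈ collisionFree m a b c) (hk' : k' ∈ collisionFree m a b c) :
    ∑ r, star (copiesState (maskedTriple false r) a b c k) *
        copiesState (maskedTriple false r) a b c k' =
      ∑ r, star (copiesState (maskedTriple true r) a b c k) *
        copiesState (maskedTriple true r) a b c k' := by
  obtain ⟨d, hd⟩ := exists_common_choice exists_common_blockSet_translation registerLabel hk hk'
  have amplitude_eq {l : Fin 3} {x : BitString (m + 2)} (r : BitString m → BitString 2)
      (hx : ∀ v, v + d (blockIndex x) ∈ blockSet true l ↔ v ∈ blockSet false l) :
      subsetState (maskedSet r (blockSet false l)) x =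
        subsetState (maskedSet (r + d) (blockSet true l)) x :=
    subsetState_congr (by simp only [card_maskedSet, card_blockSet_true_eq])
      (by simp only [mem_maskedSet, Pi.add_apply r d, ← add_assoc, hx])
  refine Fintype.sum_equiv (Equiv.addRight d) _ _ fun r => ?_
  simp only [copiesState_maskedTriple, Equiv.coe_addRight]
  congr 2
  · exact Finset.prod_congr rfl fun p _ => amplitude_eq r (hd p).1
  · exact funext fun p => amplitude_eq r (hd p).2

theorem sum_normSq_indicator_compl_collisionFree_le (s : Bool) (r : BitString m → BitString 2) :
    ∑ k, Complex.normSq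
        ((collisionFree m a b c)ᶜ.indicator (copiesState (maskedTriple s r) a b c) k) ≤
      ((a + b + c : ℕ) : ℝ) ^ 2 / 2 ^ m := by
  classical
  let μ (p : Fin a ⊕ Fin b ⊕ Fin c) (x : BitString (m + 2)) : ℝ :=
    Complex.normSq (subsetState (maskedSet r (blockSet s (registerLabel p))) x)
  calc ∑ k, Complex.normSq
        ((collisionFree m a b c)ᶜ.indicator (copiesState (maskedTriple s r) a b c) k)
      = ∑ k : Fin a ⊕ Fin b ⊕ Fin c → BitString (m + 2)
          with ¬ Function.Injective (blockIndex ∘ k), ∏ p, μ p (k p) := by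
        rw [Finset.sum_filter, ← (registers _ a b c).sum_comp]
        refine Finset.sum_congr rfl fun k _ => ?_
        by_cases hk : Function.Injective (blockIndex ∘ registers _ a b c k) <;>
          simp [collisionFree, hk, μ, copiesState_maskedTriple]
    _ ≤ (Fintype.card (Fin a ⊕ Fin b ⊕ Fin c) : ℝ) ^ 2 * (1 / 2 ^ m) :=
        sum_prod_filter_not_injective_le (fun _ _ => Complex.normSq_nonneg _)
          (fun _ => sum_normSq_subsetState (maskedSet_nonempty r (blockSet_nonempty s _)))
          (by positivity)
          (fun _ w =>
            (sum_normSq_subsetState_maskedSet_block r (blockSet_nonempty s _) w).le)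
    _ = ((a + b + c : ℕ) : ℝ) ^ 2 / 2 ^ m := by
        simp [div_eq_mul_inv, add_assoc]

theorem two_pow_le_of_distinguishable_maskedTriple
    (h : DistinguishableFromCopies (Set.range (maskedTriple (m := m) false))
      (Set.range (maskedTriple true)) a b c) :
    (2 : ℝ) ^ m ≤ 90 * ((a + b + c : ℕ) : ℝ) ^ 2 := by
  obtain ⟨E, hE, accept, reject⟩ := h
  have h := hE.one_div_ninety_le_of_gram_eq
    (fun k hk k' hk' => gram_copiesState_maskedTriple_eq hk hk')
    (sum_normSq_indicator_compl_collisionFree_le false)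
    (sum_normSq_indicator_compl_collisionFree_le true)
    (fun r => accept _ ⟨r, rfl⟩) (fun r => reject _ ⟨r, rfl⟩)
  rw [div_le_div_iff₀ (by norm_num) (by positivity)] at h
  linarith

end HardTriples

section PromiseProblem

variable {n a b c : ℕ}

theorem DistinguishableFromCopies.mono {S₀ S₀' S₁ S₁' : Set (SetTriple n)} (h₀ : S₀' ⊆ S₀)
    (h₁ : S₁' ⊆ S₁) (h : DistinguishableFromCopies S₀ S₁ a b c) :
    DistinguishableFromCopies S₀' S₁' a b c :=
  let ⟨E, hE, accept, reject⟩ := h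
  ⟨E, hE, fun T hT => accept T (h₀ hT), fun T hT => reject T (h₁ hT)⟩

theorem not_distinguishableFromCopies_zero {S₀ S₁ : Set (SetTriple n)} (h₀ : S₀.Nonempty)
    (h₁ : S₁.Nonempty) : ¬ DistinguishableFromCopies S₀ S₁ 0 0 0 := by
  rintro ⟨E, -, accept, reject⟩
  obtain ⟨T, hT⟩ := h₀
  obtain ⟨T', hT'⟩ := h₁
  have state_eq : copiesState T 0 0 0 = copiesState T' 0 0 0 := by
    ext k
    simp [copiesState, tensorProd, tensorPow]
  have hacc := accept T hT
  rw [state_eq] at hacc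
  linarith [reject T' hT']

/-- The triples of nonempty subsets of `{0,1}^n`, the inputs for which all three subset states
are unit vectors. -/
def nonemptyTriples (n : ℕ) : Set (SetTriple n) :=
  {T | T.1.Nonempty ∧ T.2.1.Nonempty ∧ T.2.2.Nonempty}

/-- The largest family allowed as `S₀`: enlarging a family only makes distinguishing harder. -/
def denseTriples (n : ℕ) : Set (SetTriple n) :=
  {T ∈ nonemptyTriples n | 1 / 16 ≤ tripleIntersectionDensity T}

/-- The largest family allowed as `S₁`. -/
def disjointTriples (n : ℕ) : Set (SetTriple n) :=
  {T ∈ nonemptyTriples n | tripleIntersectionDensity T = 0}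

theorem denseTriples_nonempty (n : ℕ) : (denseTriples n).Nonempty :=
  ⟨(Finset.univ, Finset.univ, Finset.univ), by
    norm_num [denseTriples, nonemptyTriples, tripleIntersectionDensity, Finset.univ_nonempty]⟩

theorem disjointTriples_nonempty (hn : n ≠ 0) : (disjointTriples n).Nonempty := by
  have : NeZero n := ⟨hn⟩
  obtain ⟨x, y, hxy⟩ := exists_pair_ne (BitString n)
  exact ⟨({x}, {x}, {y}), by
    simp [disjointTriples, nonemptyTriples, tripleIntersectionDensity, hxy]⟩

theorem maskedTriple_mem_nonemptyTriples {m : ℕ} (s : Bool) (r : BitString m → BitString 2) :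
    maskedTriple s r ∈ nonemptyTriples (m + 2) :=
  ⟨maskedSet_nonempty r (blockSet_nonempty s 0), maskedSet_nonempty r (blockSet_nonempty s 1),
    maskedSet_nonempty r (blockSet_nonempty s 2)⟩

theorem range_maskedTriple_false_subset_denseTriples (m : ℕ) :
    Set.range (maskedTriple (m := m) false) ⊆ denseTriples (m + 2) := by
  rintro _ ⟨r, rfl⟩
  have hcard : (blockSet false 0 ∩ blockSet false 1 ∩ blockSet false 2).card = 1 := by decide
  refine ⟨maskedTriple_mem_nonemptyTriples false r, ?_⟩
  rw [tripleIntersectionDensity_maskedTriple, hcard]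
  norm_num

theorem range_maskedTriple_true_subset_disjointTriples (m : ℕ) :
    Set.range (maskedTriple (m := m) true) ⊆ disjointTriples (m + 2) := by
  rintro _ ⟨r, rfl⟩
  have hcard : (blockSet true 0 ∩ blockSet true 1 ∩ blockSet true 2).card = 0 := by decide
  refine ⟨maskedTriple_mem_nonemptyTriples true r, ?_⟩
  rw [tripleIntersectionDensity_maskedTriple, hcard]
  norm_num

theorem two_pow_le_of_distinguishable_dense_disjoint (hn : n ≠ 0)
    (h : DistinguishableFromCopies (denseTriples n) (disjointTriples n) a b c) :
    (2 : ℝ) ^ n ≤ (60 * (max a (max b c) : ℕ)) ^ 2 := by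
  set t := max a (max b c)
  obtain rfl | hn₂ : n = 1 ∨ 2 ≤ n := by lia
  · have ht : 1 ≤ t := by
      by_contra! ht
      obtain ⟨rfl, rfl, rfl⟩ : a = 0 ∧ b = 0 ∧ c = 0 := by lia
      exact not_distinguishableFromCopies_zero (denseTriples_nonempty 1)
        (disjointTriples_nonempty hn) h
    have ht' : (1 : ℝ) ≤ t := by exact_mod_cast ht
    nlinarith
  · obtain ⟨m, rfl⟩ := Nat.exists_eq_add_of_le' hn₂
    have hsum : a + b + c ≤ 3 * t := by lia
    calc (2 : ℝ) ^ (m + 2) = 4 * 2 ^ m := by ring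
      _ ≤ 4 * (90 * ((a + b + c : ℕ) : ℝ) ^ 2) := by
        gcongr
        exact two_pow_le_of_distinguishable_maskedTriple <| h.mono
          (range_maskedTriple_false_subset_denseTriples m)
          (range_maskedTriple_true_subset_disjointTriples m)
      _ ≤ 4 * (90 * ((3 * t : ℕ) : ℝ) ^ 2) := by gcongr
      _ ≤ (60 * t) ^ 2 := by
        push_cast
        linarith [sq_nonneg (t : ℝ)]

end PromiseProblem

theorem mainTheorem8 :
    ∃ (S₀ S₁ : (n : ℕ) → Set (SetTriple n)) (κ : ℝ), 0 < κ ∧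
      ∀ n : ℕ, 1 ≤ n →
        (S₀ n).Nonempty ∧ (S₁ n).Nonempty ∧
        (∀ T ∈ S₀ n ∪ S₁ n, T.1.Nonempty ∧ T.2.1.Nonempty ∧ T.2.2.Nonempty) ∧
        (∀ T ∈ S₀ n, 1 / 16 ≤ tripleIntersectionDensity T) ∧
        (∀ T ∈ S₁ n, tripleIntersectionDensity T = 0) ∧
        ∀ a b c : ℕ, DistinguishableFromCopies (S₀ n) (S₁ n) a b c →
          κ * (2 : ℝ) ^ ((n : ℝ) / 2) ≤ (max a (max b c) : ℕ) := by
  refine ⟨denseTriples, disjointTriples, 1 / 60, by norm_num, fun n hn => ?_⟩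
  have hn₀ : n ≠ 0 := by lia
  refine ⟨denseTriples_nonempty n, disjointTriples_nonempty hn₀, ?_, fun _ hT => hT.2,
    fun _ hT => hT.2, fun a b c h => ?_⟩
  · rintro T (hT | hT) <;> exact hT.1
  · have hsqrt : (2 : ℝ) ^ ((n : ℝ) / 2) ≤ 60 * (max a (max b c) : ℕ) := by
      refine le_of_sq_le_sq ?_ (by positivity)
      rw [← Real.rpow_mul_natCast zero_le_two, Nat.cast_two, div_mul_cancel₀ _ two_ne_zero,
        Real.rpow_natCast]
      exact two_pow_le_of_distinguishable_dense_disjoint hn₀ h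
    linarith
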